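/- Let $n\ge 0$, let $b_0<b_1<\dots<b_{2n}$ be real numbers and let $\Gamma$ be the compact hyperelliptic Riemann surface of genus $n$ of the curve $w^2=-\prod_{i=0}^{2n}(\lambda-b_i)$ (completed by one point over $\lambda=\infty$). For $k=1,\dots,n$ let $\alpha_k\subset\Gamma$ be the closed curve which is the preimage of the interval $[b_{2k-1},b_{2k}]$ under $(\lambda,w)\mapsto\lambda$, with a fixed orientation. Let $\mathcal G_{(1)},\dots,\mathcal G_{(N)}$ be $C^1$ paths with parameter interval $[0,1]$, each of them lying in one of the curves $\alpha_1,\dots,\alpha_n$, such that 1. the velocity vector of every path $\mathcal G_{(j)}$ is everywhere non-zero; 2. for every $k$, all the paths $\mathcal G_{(j)}$ lying in $\alpha_k$ have the same orientation with respect to the orientation of $\alpha_k$ (for each $k$, either all of them run in the direction of $\alpha_k$, or all of them run against it). Let $\mathcal G_k$ be the collection of those paths $\mathcal G_{(j)}$ that lie in $\alpha_k$, and let $\int_{\mathcal G_k}\omega$ denote the sum of the integrals of $\omega$ over these paths (it is $0$ if $\mathcal G_k=\varnothing$). (a) For every $k$ with $\mathcal G_k\neq\varnothing$ there exists a holomorphic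 differential $\omega$ on $\Gamma$ such that $$\int_{\mathcal G_l}\omega=\delta_{kl},\qquad l=1,\dots,n.$$ (b) Let $\hat\omega_1,\dots,\hat\omega_n$ be holomorphic differentials on $\Gamma$ with $\oint_{\alpha_j}\hat\omega_k=\delta_{jk}$, $j,k=1,\dots,n$ (the standard normalized basis), and let $\mathcal J\subseteq\{1,\dots,n\}$ be such that $\mathcal G_k\neq\varnothing$ for every $k\in\mathcal J$. Then the matrix $$\mathcal A_{kl}=\int_{\mathcal G_k}\hat\omega_l,\qquad k,l\in\mathcal J,$$ is non-degenerate. -/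

import Mathlib

open Set Topology Polynomial

noncomputable section

namespace RealHyperelliptic

/-! ### Holomorphic one-forms on a plane curve `y² = f(x)` -/

/-- The affine plane curve `y² = f(x)` in `ℂ²`. -/
def planeCurve (f : ℂ[X]) : Set (ℂ × ℂ) := {p | p.2 ^ 2 = f.eval p.1}

/-- The tangent line at `p = (x, y)` of the curve `y² = f(x)`, as a subspace of `ℂ²`: the kernel of
`2 y dy - f'(x) dx`. It is one-dimensional at every point when `f` has simple roots. -/
def tangentLine (f : ℂ[X]) (p : ℂ × ℂ) : Submodule ℂ (ℂ × ℂ) where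
  carrier := {v | 2 * p.2 * v.2 = f.derivative.eval p.1 * v.1}
  add_mem' := by
    intro u v hu hv
    change 2 * p.2 * (u.2 + v.2) = f.derivative.eval p.1 * (u.1 + v.1)
    change 2 * p.2 * u.2 = f.derivative.eval p.1 * u.1 at hu
    change 2 * p.2 * v.2 = f.derivative.eval p.1 * v.1 at hv
    rw [mul_add, mul_add, hu, hv]
  zero_mem' := by simp
  smul_mem' := by
    intro c v hv
    change 2 * p.2 * (c * v.2) = f.derivative.eval p.1 * (c * v.1)
    change 2 * p.2 * v.2 = f.derivative.eval p.1 * v.1 at hv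
    linear_combination c * hv

/-- A holomorphic one-form on the smooth affine curve `y² = f(x)`: a covector on each tangent line
which, locally, is the restriction of a holomorphic one-form of the ambient `ℂ²`. -/
structure HolomorphicForm (f : ℂ[X]) where
  /-- the covector at a point -/
  toFun : (p : planeCurve f) → (tangentLine f p →ₗ[ℂ] ℂ)
  holomorphic : ∀ p : planeCurve f, ∃ A : ℂ × ℂ → (ℂ × ℂ →L[ℂ] ℂ), AnalyticAt ℂ A p ∧
    ∀ᶠ q : planeCurve f in 𝓝 p, ∀ v : tangentLine f q, toFun q v = A q v

open Classical in
/-- The value `ω_p(v)` for `p` on the curve and `v` tangent to the curve at `p` (and `0` for other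
pairs `(p, v)`). -/
def HolomorphicForm.eval {f : ℂ[X]} (ω : HolomorphicForm f) (p v : ℂ × ℂ) : ℂ :=
  if h : p ∈ planeCurve f ∧ v ∈ tangentLine f p then ω.toFun ⟨p, h.1⟩ ⟨v, h.2⟩ else 0

/-! ### The compact curve `Γ : w² = -∏ (λ - b i)` of genus `n` and its holomorphic differentials

`Γ` is glued from two smooth affine curves: `w² = -∏ (λ - b i)`, and, around the point at infinity,
`v² = -μ ∏ (1 - b i μ)`, by means of `μ = 1 / λ`, `v = w / λ ^ (n + 1)`. The only point of `Γ`
outside the first curve is `(μ, v) = (0, 0)`. -/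

/-- The polynomial `-∏ (λ - b i)`. -/
def finitePoly {n : ℕ} (b : Fin (2 * n + 1) → ℝ) : ℂ[X] := -∏ i, (X - C (b i : ℂ))

/-- The polynomial `-μ ∏ (1 - b i μ)`. -/
def infinityPoly {n : ℕ} (b : Fin (2 * n + 1) → ℝ) : ℂ[X] := -(X * ∏ i, (1 - C (b i : ℂ) * X))

/-- The gluing map `(λ, w) ↦ (1 / λ, w / λ ^ (n + 1))`, for `λ ≠ 0`. -/
def gluing (n : ℕ) (p : ℂ × ℂ) : ℂ × ℂ := (1 / p.1, p.2 / p.1 ^ (n + 1))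

/-- A holomorphic differential on the compact curve `Γ`: holomorphic one-forms on the two affine
curves which agree on their overlap. -/
structure HolomorphicDifferential {n : ℕ} (b : Fin (2 * n + 1) → ℝ) where
  /-- the restriction to the finite part of `Γ` -/
  finite : HolomorphicForm (finitePoly b)
  /-- the restriction to a neighbourhood of the point at infinity -/
  infinity : HolomorphicForm (infinityPoly b)
  compatible : ∀ p ∈ planeCurve (finitePoly b), p.1 ≠ 0 → ∀ v ∈ tangentLine (finitePoly b) p,
    infinity.eval (gluing n p) (fderiv ℂ (gluing n) p v) = finite.eval p v

/-- The oval over the `k`-th gap, `k = 0, …, n - 1`: the preimage in `Γ` of the real interval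
`[b (2k+1), b (2k+2)]` under `(λ, w) ↦ λ`. -/
def oval {n : ℕ} (b : Fin (2 * n + 1) → ℝ) (k : Fin n) : Set (ℂ × ℂ) :=
  {p | p ∈ planeCurve (finitePoly b) ∧
    ∃ x : ℝ, b ⟨2 * k + 1, by omega⟩ ≤ x ∧ x ≤ b ⟨2 * k + 2, by omega⟩ ∧ p.1 = (x : ℂ)}

/-! ### Paths -/

/-- The velocity at time `t` of a path with parameter interval `[0, 1]`. -/
def velocity (γ : ℝ → ℂ × ℂ) (t : ℝ) : ℂ × ℂ := derivWithin γ (Icc 0 1) t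

/-- `γ : [0, 1] → S` is a `C¹` path in the set `S` with nowhere vanishing velocity (the values of
`γ` outside `[0, 1]` are irrelevant). -/
structure IsRegularPathIn (γ : ℝ → ℂ × ℂ) (S : Set (ℂ × ℂ)) : Prop where
  contDiffOn : ContDiffOn ℝ 1 γ (Icc 0 1)
  velocity_ne_zero : ∀ t ∈ Icc (0 : ℝ) 1, velocity γ t ≠ 0
  mem : ∀ t ∈ Icc (0 : ℝ) 1, γ t ∈ S

/-- `a` runs exactly once around the closed curve `S`, with nowhere vanishing velocity. -/
structure IsCycle (a : ℝ → ℂ × ℂ) (S : Set (ℂ × ℂ)) : Prop extends IsRegularPathIn a S where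
  closed : a 0 = a 1
  injOn : InjOn a (Ico 0 1)
  surjOn : SurjOn a (Icc 0 1) S

/-- At each of its points, the path `γ` runs in the direction of the cycle `a`. -/
def PositivelyOriented (γ a : ℝ → ℂ × ℂ) : Prop :=
  ∀ t ∈ Icc (0 : ℝ) 1, ∀ s ∈ Icc (0 : ℝ) 1, γ t = a s →
    ∃ c : ℝ, 0 < c ∧ velocity γ t = c • velocity a s

/-- At each of its points, the path `γ` runs against the direction of the cycle `a`. -/
def NegativelyOriented (γ a : ℝ → ℂ × ℂ) : Prop :=
  ∀ t ∈ Icc (0 : ℝ) 1, ∀ s ∈ Icc (0 : ℝ) 1, γ t = a s →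
    ∃ c : ℝ, c < 0 ∧ velocity γ t = c • velocity a s

/-- The integral of a holomorphic differential along a path in the finite part of `Γ`. -/
def pathIntegral {n : ℕ} {b : Fin (2 * n + 1) → ℝ} (ω : HolomorphicDifferential b)
    (γ : ℝ → ℂ × ℂ) : ℂ :=
  ∫ t in (0 : ℝ)..1, ω.finite.eval (γ t) (velocity γ t)

/-- The integral over `𝒢_l`, the collection of those paths `γ i` of the family that lie in the
`l`-th cycle (`κ i = l`): the sum of the integrals along these paths. -/
def groupIntegral {n N : ℕ} {b : Fin (2 * n + 1) → ℝ} (ω : HolomorphicDifferential b)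
    (γ : Fin N → ℝ → ℂ × ℂ) (κ : Fin N → Fin n) (l : Fin n) : ℂ :=
  ∑ i with κ i = l, pathIntegral ω (γ i)

end RealHyperelliptic

end

/-! A holomorphic differential on `Γ` is `P(λ) dλ / w` with `deg P < n`
(`HolomorphicDifferential.exists_coeff_eq`): averaging its coefficient over the two sheets gives an
entire function of controlled growth, and the squared difference of the sheets has too many zeros
not to vanish.

Over a gap `-∏ (λ - b i)` is nonnegative, so the ovals are real, and along a regular path in an oval
the form `dλ / w` has a real, continuous, nowhere zero density (`pathWeight`). The orientation
hypothesis gives all paths of one group the same sign of density (`exists_sign`). Hence, for real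
`P`, the integral over a nonempty group can vanish only if `P` has a zero in the open gap. If this
happens over all `n` gaps, `P` has `n` distinct zeros and degree less than `n`, so `P = 0`
(`det_ne_zero_of_gap_pos`).

The argument applies equally if some groups are replaced by the full cycles, which makes
`momentMatrix` invertible (`det_momentMatrix_ne_zero`). Part (a) solves the corresponding linear
system. For (b), a kernel vector `c` yields the differential `∑ c l ω̂ l` with zero integrals over
the groups in `J` and over the cycles outside `J`; it is therefore zero, and its cycle integrals,
which are the `c l`, vanish. -/

noncomputable section

namespace RealHyperelliptic

/-! ### The form `dx / y` as a frame on `y² = f(x)` -/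

/-- The tangent vector of the curve `y² = f(x)` on which the form `dx / y` takes the value `1`. -/
def tangentVector (f : ℂ[X]) (p : ℂ × ℂ) : ℂ × ℂ := (p.2, f.derivative.eval p.1 / 2)

theorem tangentVector_mem (f : ℂ[X]) (p : ℂ × ℂ) : tangentVector f p ∈ tangentLine f p := by
  change 2 * p.2 * (f.derivative.eval p.1 / 2) = f.derivative.eval p.1 * p.2
  ring

/-- All roots of `f` are simple. -/
def HasSimpleRoots (f : ℂ[X]) : Prop := ∀ z, f.eval z = 0 → f.derivative.eval z ≠ 0

open Classical in
/-- The form `dx / y` on the curve `y² = f(x)`, written as `2 dy / f'(x)` where `y = 0`. -/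
def tangentCoord (f : ℂ[X]) (p : ℂ × ℂ) : ℂ × ℂ →ₗ[ℂ] ℂ :=
  if p.2 = 0 then (2 / f.derivative.eval p.1) • LinearMap.snd ℂ ℂ ℂ
  else (1 / p.2) • LinearMap.fst ℂ ℂ ℂ

theorem derivative_ne_zero_of_mem {f : ℂ[X]} (hf : HasSimpleRoots f) {p : ℂ × ℂ}
    (hp : p ∈ planeCurve f) (h : p.2 = 0) : f.derivative.eval p.1 ≠ 0 := by
  have hp' : p.2 ^ 2 = f.eval p.1 := hp
  exact hf _ (by rw [← hp', h]; ring)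

theorem tangentCoord_smul {f : ℂ[X]} (hf : HasSimpleRoots f) {p v : ℂ × ℂ}
    (hp : p ∈ planeCurve f) (hv : v ∈ tangentLine f p) :
    tangentCoord f p v • tangentVector f p = v := by
  have hv' : 2 * p.2 * v.2 = f.derivative.eval p.1 * v.1 := hv
  by_cases h : p.2 = 0
  · have hd := derivative_ne_zero_of_mem hf hp h
    have h1 : v.1 = 0 := by simpa [h, hd] using hv'
    ext
    · simp [tangentVector, h, h1]
    · simp only [tangentCoord, tangentVector, h, if_true]
      simp
      field_simp
  · ext
    · simp [tangentCoord, tangentVector, h]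
      field_simp
    · simp only [tangentCoord, tangentVector, h, if_false]
      simp
      field_simp
      linear_combination -hv'

theorem tangentCoord_tangentVector {f : ℂ[X]} (hf : HasSimpleRoots f) {p : ℂ × ℂ}
    (hp : p ∈ planeCurve f) : tangentCoord f p (tangentVector f p) = 1 := by
  by_cases h : p.2 = 0
  · have hd := derivative_ne_zero_of_mem hf hp h
    simp [tangentCoord, tangentVector, h, hd]
  · simp [tangentCoord, tangentVector, h]

/-- The function `g` such that the form is `g dx / y`. -/
def HolomorphicForm.coeff {f : ℂ[X]} (ω : HolomorphicForm f) (p : ℂ × ℂ) : ℂ :=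
  ω.eval p (tangentVector f p)

theorem HolomorphicForm.eval_smul_tangentVector {f : ℂ[X]} (ω : HolomorphicForm f) {p : ℂ × ℂ}
    (hp : p ∈ planeCurve f) (c : ℂ) : ω.eval p (c • tangentVector f p) = c * ω.coeff p := by
  have h := tangentVector_mem f p
  rw [HolomorphicForm.coeff, HolomorphicForm.eval, HolomorphicForm.eval,
    dif_pos ⟨hp, Submodule.smul_mem _ c h⟩, dif_pos ⟨hp, h⟩, ← smul_eq_mul, ← map_smul]
  rfl

/-- The coefficient is locally the restriction of a holomorphic function of two variables. -/
theorem HolomorphicForm.exists_analyticAt {f : ℂ[X]} (ω : HolomorphicForm f) {p : ℂ × ℂ}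
    (hp : p ∈ planeCurve f) :
    ∃ G : ℂ × ℂ → ℂ, AnalyticAt ℂ G p ∧ ∀ᶠ q in 𝓝 p, q ∈ planeCurve f → ω.coeff q = G q := by
  obtain ⟨A, hA, h⟩ := ω.holomorphic ⟨p, hp⟩
  refine ⟨fun q => A q (tangentVector f q), ?_, ?_⟩
  · have ht : AnalyticAt ℂ (tangentVector f) p :=
      analyticAt_snd.prod ((analyticAt_fst.aeval_polynomial f.derivative).mul
        (analyticAt_const (v := 2⁻¹)))
    exact ((ContinuousLinearMap.id ℂ (ℂ × ℂ →L[ℂ] ℂ)).analyticAt_bilinear _).comp₂ hA ht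
  · rw [nhds_subtype_eq_comap, Filter.eventually_comap] at h
    filter_upwards [h] with q hq hqf
    rw [HolomorphicForm.coeff, HolomorphicForm.eval, dif_pos ⟨hqf, tangentVector_mem f q⟩]
    exact hq ⟨q, hqf⟩ rfl _

/-- The form `P(x) dx / y` on the curve `y² = f(x)`. -/
def polyForm {f : ℂ[X]} (hf : HasSimpleRoots f) (P : ℂ[X]) : HolomorphicForm f where
  toFun p := (P.eval p.1.1 • tangentCoord f p.1).comp (tangentLine f p.1).subtype
  holomorphic := by
    rintro ⟨p, hp⟩
    have hP : AnalyticAt ℂ (fun q : ℂ × ℂ => P.eval q.1) p := analyticAt_fst.aeval_polynomial P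
    have hf' : AnalyticAt ℂ (fun q : ℂ × ℂ => f.derivative.eval q.1) p :=
      analyticAt_fst.aeval_polynomial f.derivative
    have hc : ∀ q ∈ planeCurve f, ∀ v ∈ tangentLine f q,
        (q.2 ≠ 0 → tangentCoord f q v = v.1 / q.2) ∧
        (f.derivative.eval q.1 ≠ 0 → tangentCoord f q v = 2 * v.2 / f.derivative.eval q.1) := by
      intro q hq v hv
      have hv' : 2 * q.2 * v.2 = f.derivative.eval q.1 * v.1 := hv
      constructor
      · intro h
        simp [tangentCoord, h]
        field_simp
      · intro h
        by_cases h2 : q.2 = 0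
        · simp [tangentCoord, h2]
          field_simp
        · simp [tangentCoord, h2]
          field_simp
          linear_combination -hv'
    by_cases h : p.2 = 0
    · have hd := derivative_ne_zero_of_mem hf hp h
      refine ⟨fun q => (P.eval q.1 * (2 / f.derivative.eval q.1)) •
        ContinuousLinearMap.snd ℂ ℂ ℂ, ?_, ?_⟩
      · exact (hP.mul (analyticAt_const.div hf' hd)).smul analyticAt_const
      · have := ContinuousAt.comp (x := (⟨p, hp⟩ : planeCurve f)) hf'.continuousAt
          continuous_subtype_val.continuousAt
        filter_upwards [this.eventually_ne hd] with q hq v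
        have := (hc q q.2 v v.2).2 hq
        simp [this]
        ring
    · refine ⟨fun q => (P.eval q.1 * (1 / q.2)) • ContinuousLinearMap.fst ℂ ℂ ℂ, ?_, ?_⟩
      · exact (hP.mul (analyticAt_const.div analyticAt_snd h)).smul analyticAt_const
      · have : ContinuousAt (fun q : planeCurve f => q.1.2) ⟨p, hp⟩ := by fun_prop
        filter_upwards [this.eventually_ne h] with q hq v
        have := (hc q q.2 v v.2).1 hq
        simp [this]
        ring

theorem coeff_polyForm {f : ℂ[X]} (hf : HasSimpleRoots f) (P : ℂ[X]) {p : ℂ × ℂ}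
    (hp : p ∈ planeCurve f) : (polyForm hf P).coeff p = P.eval p.1 := by
  rw [HolomorphicForm.coeff, HolomorphicForm.eval, dif_pos ⟨hp, tangentVector_mem f p⟩]
  change P.eval p.1 • tangentCoord f p (tangentVector f p) = _
  rw [tangentCoord_tangentVector hf hp, smul_eq_mul, mul_one]

/-! ### The two charts of `Γ` and the gluing between them -/

variable {n : ℕ} {b : Fin (2 * n + 1) → ℝ}

theorem eval_finitePoly (b : Fin (2 * n + 1) → ℝ) (z : ℂ) :
    (finitePoly b).eval z = -∏ i, (z - b i) := by
  simp [finitePoly, eval_prod]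

theorem eval_infinityPoly (b : Fin (2 * n + 1) → ℝ) (z : ℂ) :
    (infinityPoly b).eval z = -(z * ∏ i, (1 - b i * z)) := by
  simp [infinityPoly, eval_prod]

theorem eval_finitePoly_eq_mul (b : Fin (2 * n + 1) → ℝ) {z : ℂ} (hz : z ≠ 0) :
    (finitePoly b).eval z = z ^ (2 * n + 2) * (infinityPoly b).eval z⁻¹ := by
  have h : ∏ i, (z - b i) = z ^ (2 * n + 1) * ∏ i, (1 - b i * z⁻¹) := by
    have : z ^ (2 * n + 1) = ∏ _i : Fin (2 * n + 1), z := by simp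
    rw [this, ← Finset.prod_mul_distrib]
    refine Finset.prod_congr rfl fun i _ => ?_
    field_simp
  rw [eval_finitePoly, eval_infinityPoly, h, pow_succ z (2 * n + 1)]
  linear_combination (z ^ (2 * n + 1) * ∏ i, (1 - b i * z⁻¹)) * mul_inv_cancel₀ hz

theorem eval_derivative_finitePoly_eq (b : Fin (2 * n + 1) → ℝ) {z : ℂ} (hz : z ≠ 0) :
    (finitePoly b).derivative.eval z =
      (2 * n + 2) * z ^ (2 * n + 1) * (infinityPoly b).eval z⁻¹ -
        z ^ (2 * n) * (infinityPoly b).derivative.eval z⁻¹ := by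
  have h1 := (finitePoly b).hasDerivAt z
  have h2 : HasDerivAt (fun y : ℂ => y ^ (2 * n + 2) * (infinityPoly b).eval y⁻¹) _ z :=
    (hasDerivAt_pow (2 * n + 2) z).mul
      (((infinityPoly b).hasDerivAt z⁻¹).comp z (hasDerivAt_inv hz))
  have h3 := h2.congr_of_eventuallyEq (f₁ := fun y => (finitePoly b).eval y) <| by
    filter_upwards [eventually_ne_nhds hz] with y hy using eval_finitePoly_eq_mul b hy
  rw [h1.unique h3]
  have h4 : 2 * n + 2 - 1 = 2 * n + 1 := rfl
  rw [h4]
  push_cast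
  field_simp
  ring

theorem hasSimpleRoots_finitePoly (hb : StrictMono b) : HasSimpleRoots (finitePoly b) := by
  intro z hz
  have hs : (∏ i, (X - C (b i : ℂ))).Separable := by
    rw [separable_prod_X_sub_C_iff]
    exact Complex.ofReal_injective.comp hb.injective
  rw [finitePoly, eval_neg, neg_eq_zero] at hz
  rw [finitePoly, derivative_neg, eval_neg, neg_ne_zero]
  exact hs.eval₂_derivative_ne_zero (RingHom.id ℂ) (by simpa [eval₂_id] using hz)

/-- A multiple root away from `0` would be carried by inversion to a multiple root of `finitePoly
b`; at `0` the derivative is `-1`. -/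
theorem hasSimpleRoots_infinityPoly (hb : StrictMono b) : HasSimpleRoots (infinityPoly b) := by
  intro z hz
  by_cases h0 : z = 0
  · subst h0
    simp [infinityPoly, eval_prod]
  · have h1 : z⁻¹ ≠ 0 := inv_ne_zero h0
    have h2 := eval_finitePoly_eq_mul b h1
    have h3 := eval_derivative_finitePoly_eq b h1
    rw [inv_inv, hz] at h2 h3
    intro h4
    exact hasSimpleRoots_finitePoly hb z⁻¹ (by simpa using h2) (by simpa [h4] using h3)

theorem gluing_mem {p : ℂ × ℂ} (hp : p ∈ planeCurve (finitePoly b)) (h0 : p.1 ≠ 0) :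
    gluing n p ∈ planeCurve (infinityPoly b) := by
  have hp' : p.2 ^ 2 = (finitePoly b).eval p.1 := hp
  change (p.2 / p.1 ^ (n + 1)) ^ 2 = (infinityPoly b).eval (1 / p.1)
  rw [div_pow, hp', eval_finitePoly_eq_mul b h0, one_div,
    div_eq_iff (by positivity)]
  ring

theorem fderiv_gluing_apply (n : ℕ) {p : ℂ × ℂ} (h0 : p.1 ≠ 0) (v : ℂ × ℂ) :
    fderiv ℂ (gluing n) p v =
      (-v.1 / p.1 ^ 2, v.2 / p.1 ^ (n + 1) - (n + 1) * p.2 * v.1 / p.1 ^ (n + 2)) := by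
  have h1 : HasFDerivAt (fun q : ℂ × ℂ => q.1) (ContinuousLinearMap.fst ℂ ℂ ℂ) p := hasFDerivAt_fst
  have h2 : HasFDerivAt (fun q : ℂ × ℂ => q.2) (ContinuousLinearMap.snd ℂ ℂ ℂ) p := hasFDerivAt_snd
  have h3 := (hasDerivAt_inv h0).comp_hasFDerivAt p h1
  have h4 := ((hasDerivAt_inv (pow_ne_zero (n + 1) h0)).comp p.1
    (hasDerivAt_pow (n + 1) p.1)).comp_hasFDerivAt p h1
  have h5 := h3.prodMk (h2.mul h4)
  have h6 : gluing n = fun q : ℂ × ℂ =>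
      ((fun y : ℂ => y⁻¹) q.1, q.2 * ((fun y : ℂ => y⁻¹) ∘ fun y : ℂ => y ^ (n + 1)) q.1) := by
    funext q
    simp [gluing, div_eq_mul_inv]
  rw [h6]
  erw [h5.fderiv]
  ext
  · simp
    field_simp
  · simp
    field_simp
    ring

/-- This is `dμ / v = -λ ^ (n - 1) dλ / w` in dual form; the quotient `λ ^ n / λ` avoids truncated
subtraction at `n = 0`. -/
theorem fderiv_gluing_tangentVector {p : ℂ × ℂ} (hp : p ∈ planeCurve (finitePoly b))
    (h0 : p.1 ≠ 0) : fderiv ℂ (gluing n) p (tangentVector (finitePoly b) p) =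
      (-(p.1 ^ n / p.1)) • tangentVector (infinityPoly b) (gluing n p) := by
  have hp' : p.2 ^ 2 = (finitePoly b).eval p.1 := hp
  rw [eval_finitePoly_eq_mul b h0] at hp'
  rw [fderiv_gluing_apply n h0]
  ext
  · simp [tangentVector, gluing]
    field_simp
    ring
  · simp only [tangentVector, gluing, Prod.smul_mk, smul_eq_mul, one_div]
    rw [eval_derivative_finitePoly_eq b h0]
    field_simp
    rw [hp']
    ring_nf

/-- The coefficients of a holomorphic differential in the two charts. -/
theorem HolomorphicDifferential.coeff_finite (ω : HolomorphicDifferential b) {p : ℂ × ℂ}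
    (hp : p ∈ planeCurve (finitePoly b)) (h0 : p.1 ≠ 0) :
    ω.finite.coeff p = -(p.1 ^ n / p.1) * ω.infinity.coeff (gluing n p) := by
  have h := ω.compatible p hp h0 _ (tangentVector_mem _ p)
  rw [fderiv_gluing_tangentVector hp h0,
    HolomorphicForm.eval_smul_tangentVector _ (gluing_mem hp h0)] at h
  exact h.symm

/-- The differential `∑ a_j λ^j dλ / w`. -/
def polyDifferential (hb : StrictMono b) (a : Fin n → ℂ) : HolomorphicDifferential b where
  finite := polyForm (hasSimpleRoots_finitePoly hb) (∑ j, C (a j) * X ^ (j : ℕ))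
  -- Under `μ = 1 / λ` the form `λ ^ j dλ / w` becomes `-μ ^ (n - 1 - j) dμ / v`; the exponent is a
  -- true difference because `j < n`.
  infinity := polyForm (hasSimpleRoots_infinityPoly hb)
    (-∑ j, C (a j) * X ^ (n - 1 - (j : ℕ)))
  compatible := by
    intro p hp h0 v hv
    rw [← tangentCoord_smul (hasSimpleRoots_finitePoly hb) hp hv, map_smul,
      fderiv_gluing_tangentVector hp h0, smul_smul,
      HolomorphicForm.eval_smul_tangentVector _ (gluing_mem hp h0),
      HolomorphicForm.eval_smul_tangentVector _ hp, coeff_polyForm _ _ hp,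
      coeff_polyForm _ _ (gluing_mem hp h0), mul_assoc]
    congr 1
    simp only [eval_neg, eval_finsetSum, eval_mul, eval_C, eval_pow, eval_X, gluing, neg_mul_neg,
      Finset.mul_sum]
    refine Finset.sum_congr rfl fun j _ => ?_
    have hj : n = (n - 1 - (j : ℕ)) + j + 1 := by omega
    have : p.1 ^ n = p.1 ^ (n - 1 - (j : ℕ)) * p.1 ^ (j : ℕ) * p.1 := by
      rw [← pow_add, ← pow_succ, ← hj]
    rw [this, one_div, inv_pow]
    field_simp

theorem coeff_polyDifferential (hb : StrictMono b) (a : Fin n → ℂ) {p : ℂ × ℂ}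
    (hp : p ∈ planeCurve (finitePoly b)) :
    (polyDifferential hb a).finite.coeff p = ∑ j, a j * p.1 ^ (j : ℕ) := by
  rw [polyDifferential, coeff_polyForm _ _ hp]
  simp [eval_finsetSum]

/-! ### Classification of the holomorphic differentials -/

theorem tendsto_zero_of_sq {ι : Type*} {l : Filter ι} {u : ι → ℂ}
    (h : Filter.Tendsto (fun i => u i ^ 2) l (𝓝 0)) : Filter.Tendsto u l (𝓝 0) := by
  rw [tendsto_zero_iff_norm_tendsto_zero] at h ⊢
  have h1 := (Real.continuous_sqrt.tendsto 0).comp h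
  rw [Real.sqrt_zero] at h1
  refine h1.congr fun i => ?_
  simp [Real.sqrt_sq]

/-- An entire function of polynomial growth is a polynomial. -/
theorem exists_polynomial_of_growth (m : ℕ) : ∀ (F : ℂ → ℂ), Differentiable ℂ F → ∀ C : ℝ,
    (∀ᶠ z in Bornology.cobounded ℂ, ‖F z‖ ≤ C * ‖z‖ ^ m) →
    ∃ P : ℂ[X], P.natDegree ≤ m ∧ ∀ z, F z = P.eval z := by
  induction m with
  | zero =>
    intro F hF K hK
    have hb : Bornology.IsBounded (range F) := by
      have h1 : Bornology.IsBounded {z | ¬ ‖F z‖ ≤ K * ‖z‖ ^ 0} := by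
        rw [Bornology.isBounded_def]
        exact Filter.mem_of_superset hK fun z hz => not_not.2 hz
      obtain ⟨R, hR⟩ := h1.subset_closedBall 0
      have h2 := ((isCompact_closedBall (0 : ℂ) R).image hF.continuous).isBounded
      refine (h2.union (Metric.isBounded_closedBall (x := (0 : ℂ)) (r := K))).subset ?_
      rintro _ ⟨z, rfl⟩
      by_cases hz : ‖F z‖ ≤ K * ‖z‖ ^ 0
      · right
        simpa using hz
      · exact Or.inl ⟨z, hR hz, rfl⟩
    refine ⟨C (F 0), by simp, fun z => ?_⟩
    rw [eval_C]
    exact hF.apply_eq_apply_of_bounded hb z 0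
  | succ m ih =>
    intro F hF K hK
    -- The difference quotient `(F z - F 0) / z` is again entire and grows one degree slower.
    have hG : Differentiable ℂ (dslope F 0) := by
      rw [← differentiableOn_univ] at hF ⊢
      exact (Complex.differentiableOn_dslope Filter.univ_mem).2 hF
    obtain ⟨P, hP, hPF⟩ := ih (dslope F 0) hG (K + ‖F 0‖) <| by
      filter_upwards [hK, eventually_cobounded_le_norm (1 : ℝ)] with z hz h1
      have h0 : z ≠ 0 := by
        rintro rfl
        norm_num at h1
      have hzpos : 0 < ‖z‖ := norm_pos_iff.2 h0
      rw [dslope_of_ne _ h0, slope_def_field, norm_div, sub_zero, div_le_iff₀ hzpos]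
      have h2 : 1 ≤ ‖z‖ ^ (m + 1) := one_le_pow₀ h1
      calc ‖F z - F 0‖ ≤ ‖F z‖ + ‖F 0‖ := norm_sub_le _ _
        _ ≤ K * ‖z‖ ^ (m + 1) + ‖F 0‖ * ‖z‖ ^ (m + 1) := by
          gcongr
          exact le_mul_of_one_le_right (norm_nonneg _) h2
        _ = (K + ‖F 0‖) * ‖z‖ ^ m * ‖z‖ := by ring
    refine ⟨C (F 0) + X * P, ?_, fun z => ?_⟩
    · refine (natDegree_add_le _ _).trans (max_le (by simp) ?_)
      refine natDegree_mul_le.trans ?_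
      rw [natDegree_X]
      omega
    · have h := sub_smul_dslope F 0 z
      rw [sub_zero, smul_eq_mul, hPF] at h
      simp [h]

/-- A local holomorphic branch of `√f` with a prescribed value. -/
theorem exists_analyticAt_sqrt (f : ℂ[X]) {z₀ w₀ : ℂ} (h0 : f.eval z₀ ≠ 0)
    (hw : w₀ ^ 2 = f.eval z₀) :
    ∃ s : ℂ → ℂ, AnalyticAt ℂ s z₀ ∧ s z₀ = w₀ ∧ ∀ z, s z ^ 2 = f.eval z := by
  -- Normalizing by `f z₀` puts the base at `1` for `z = z₀`, inside the slit plane where the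
  -- principal power is analytic.
  refine ⟨fun z => w₀ * (f.eval z / f.eval z₀) ^ (1 / 2 : ℂ), ?_, ?_, fun z => ?_⟩
  · have h1 : AnalyticAt ℂ (fun z => f.eval z / f.eval z₀) z₀ :=
      (analyticAt_id.aeval_polynomial f).div analyticAt_const h0
    refine analyticAt_const.mul (h1.cpow analyticAt_const ?_)
    simp [div_self h0]
  · simp [div_self h0]
  · rw [mul_pow, hw, ← Complex.cpow_nat_mul]
    norm_num
    field_simp

/-- A symmetric holomorphic expression in the values of the coefficient on the two sheets is an
entire function. -/
theorem differentiable_symmetric_coeff {f : ℂ[X]} (hf : HasSimpleRoots f) (ω : HolomorphicForm f)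
    {r : ℂ → ℂ} (hr : ∀ z, r z ^ 2 = f.eval z) {S : ℂ × ℂ → ℂ} (hS : Differentiable ℂ S)
    (hsymm : ∀ x y, S (x, y) = S (y, x)) :
    Differentiable ℂ fun z => S (ω.coeff (z, r z), ω.coeff (z, -r z)) := by
  set F : ℂ → ℂ := fun z => S (ω.coeff (z, r z), ω.coeff (z, -r z)) with hF
  have hmem : ∀ {z w : ℂ}, w ^ 2 = f.eval z → (z, w) ∈ planeCurve f := fun h => h
  have key : ∀ z₀, f.eval z₀ ≠ 0 → DifferentiableAt ℂ F z₀ := by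
    intro z₀ h0
    obtain ⟨s, hs, hs0, hs2⟩ := exists_analyticAt_sqrt f h0 (hr z₀)
    -- `r` need not be continuous. Symmetry of `S` makes the choice of sheet irrelevant, so a local
    -- analytic branch may replace it.
    have hFs : F = fun z => S (ω.coeff (z, s z), ω.coeff (z, -s z)) := by
      funext z
      rcases sq_eq_sq_iff_eq_or_eq_neg.1 ((hs2 z).trans (hr z).symm) with h | h
      · simp only [hF, h]
      · simp only [hF, h, neg_neg]
        exact hsymm _ _
    obtain ⟨G₁, hG₁, he₁⟩ := ω.exists_analyticAt (hmem (hs2 z₀))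
    obtain ⟨G₂, hG₂, he₂⟩ := ω.exists_analyticAt (hmem (w := -s z₀) (by rw [neg_sq, hs2 z₀]))
    have hp₁ : AnalyticAt ℂ (fun z => (z, s z)) z₀ := analyticAt_id.prod hs
    have hp₂ : AnalyticAt ℂ (fun z => (z, -s z)) z₀ := analyticAt_id.prod hs.neg
    have hd : DifferentiableAt ℂ (fun z => S (G₁ (z, s z), G₂ (z, -s z))) z₀ := by
      have h₁ := (AnalyticAt.comp (f := fun z => (z, s z)) hG₁ hp₁).differentiableAt
      have h₂ := (AnalyticAt.comp (f := fun z => (z, -s z)) hG₂ hp₂).differentiableAt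
      exact (hS _).comp z₀ (h₁.prodMk h₂)
    rw [hFs]
    refine hd.congr_of_eventuallyEq ?_
    filter_upwards [hp₁.continuousAt.eventually he₁, hp₂.continuousAt.eventually he₂]
      with z h₁ h₂
    rw [h₁ (hmem (hs2 z)), h₂ (hmem (by rw [neg_sq, hs2 z]))]
  intro z₀
  by_cases h0 : f.eval z₀ = 0
  -- At a branch point the two sheets meet, so `F` is continuous there and the singularity is
  -- removable.
  · refine (Complex.analyticAt_of_differentiable_on_punctured_nhds_of_continuousAt ?_
      ?_).differentiableAt
    · filter_upwards [(f.hasDerivAt z₀).eventually_ne (c := 0) (hf z₀ h0)] with z hz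
        using key z hz
    · have hr0 : r z₀ = 0 := by simpa [h0] using hr z₀
      have hrc : Filter.Tendsto r (𝓝 z₀) (𝓝 0) := by
        refine tendsto_zero_of_sq ?_
        simp_rw [hr]
        simpa [h0] using f.continuous.tendsto z₀
      obtain ⟨G, hG, he⟩ := ω.exists_analyticAt (hmem (z := z₀) (w := 0) (by simp [h0]))
      have h₁ : Filter.Tendsto (fun z => (z, r z)) (𝓝 z₀) (𝓝 (z₀, 0)) :=
        Filter.tendsto_id.prodMk_nhds hrc
      have h₂ : Filter.Tendsto (fun z => (z, -r z)) (𝓝 z₀) (𝓝 (z₀, 0)) := by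
        simpa using Filter.tendsto_id.prodMk_nhds hrc.neg
      have h₃ : Filter.Tendsto (fun z => S (G (z, r z), G (z, -r z))) (𝓝 z₀)
          (𝓝 (S (G (z₀, 0), G (z₀, 0)))) :=
        (hS.continuous.tendsto _).comp ((hG.continuousAt.tendsto.comp h₁).prodMk_nhds
          (hG.continuousAt.tendsto.comp h₂))
      have h₄ : F =ᶠ[𝓝 z₀] fun z => S (G (z, r z), G (z, -r z)) := by
        filter_upwards [h₁.eventually he, h₂.eventually he] with z hz₁ hz₂
        simp only [hF]
        rw [hz₁ (hmem (hr z)), hz₂ (hmem (by rw [neg_sq, hr z]))]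
      have h₅ : F z₀ = S (G (z₀, 0), G (z₀, 0)) := by
        rw [h₄.eq_of_nhds, hr0, neg_zero]
      rw [ContinuousAt, h₅]
      exact h₃.congr' h₄.symm
  · exact key z₀ h0

/-- The gluing map carries the ends of the finite curve to the point at infinity. -/
theorem tendsto_gluing (b : Fin (2 * n + 1) → ℝ) :
    Filter.Tendsto (gluing n)
      (Filter.comap Prod.fst (Bornology.cobounded ℂ) ⊓ Filter.principal (planeCurve (finitePoly b)))
      (𝓝 (0, 0)) := by
  have h1 : Filter.Tendsto (fun p : ℂ × ℂ => 1 / p.1)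
      (Filter.comap Prod.fst (Bornology.cobounded ℂ) ⊓ Filter.principal (planeCurve (finitePoly b)))
      (𝓝 0) := by
    simp_rw [one_div]
    exact (Filter.tendsto_inv₀_cobounded.comp Filter.tendsto_comap).mono_left inf_le_left
  refine h1.prodMk_nhds (tendsto_zero_of_sq ?_)
  have h2 := ((infinityPoly b).continuous.tendsto 0).comp h1
  have h3 : (infinityPoly b).eval 0 = 0 := by simp [eval_infinityPoly]
  rw [h3] at h2
  refine h2.congr' ?_
  have h4 : ∀ᶠ p : ℂ × ℂ in Filter.comap Prod.fst (Bornology.cobounded ℂ), p.1 ≠ 0 :=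
    Filter.tendsto_comap.eventually (Bornology.eventually_ne_cobounded 0)
  filter_upwards [Filter.mem_inf_of_left h4,
    Filter.mem_inf_of_right (Filter.mem_principal_self _)] with p hp0 hp
  exact (gluing_mem hp hp0).symm

/-- Near infinity the coefficient in the other chart is bounded, and the change of frame contributes
`λ ^ (n - 1)`. -/
theorem HolomorphicDifferential.exists_norm_coeff_le (ω : HolomorphicDifferential b)
    (hn : 0 < n) : ∃ K : ℝ, ∀ᶠ z in Bornology.cobounded ℂ,
      ∀ w : ℂ, (z, w) ∈ planeCurve (finitePoly b) →
        ‖ω.finite.coeff (z, w)‖ ≤ K * ‖z‖ ^ (n - 1) := by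
  have h0 : ((0 : ℂ), (0 : ℂ)) ∈ planeCurve (infinityPoly b) := by
    simp [planeCurve, eval_infinityPoly]
  obtain ⟨G, hG, he⟩ := ω.infinity.exists_analyticAt h0
  have h1 : ∀ᶠ q in 𝓝 ((0 : ℂ), (0 : ℂ)), ‖G q‖ < ‖G (0, 0)‖ + 1 :=
    hG.continuousAt.norm.eventually_lt_const (lt_add_one _)
  have h2 := (tendsto_gluing b).eventually (he.and h1)
  rw [Filter.eventually_inf_principal, Filter.eventually_comap] at h2
  refine ⟨‖G (0, 0)‖ + 1, ?_⟩
  filter_upwards [h2, Bornology.eventually_ne_cobounded (0 : ℂ)] with z hz hz0 w hw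
  obtain ⟨h3, h4⟩ := hz (z, w) rfl hw
  rw [ω.coeff_finite hw hz0, norm_mul, norm_neg, h3 (gluing_mem hw hz0), mul_comm]
  have h5 : z ^ n / z = z ^ (n - 1) := by
    rw [div_eq_iff hz0, ← pow_succ, Nat.sub_add_cancel hn]
  simp only [h5, norm_pow]
  gcongr

/-- Every holomorphic differential on `Γ` is of the form `P(λ) dλ / w` with `deg P < n`. -/
theorem HolomorphicDifferential.exists_coeff_eq (hb : StrictMono b)
    (ω : HolomorphicDifferential b) (hn : 0 < n) :
    ∃ a : Fin n → ℂ, ∀ p ∈ planeCurve (finitePoly b),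
      ω.finite.coeff p = ∑ j, a j * p.1 ^ (j : ℕ) := by
  have hf := hasSimpleRoots_finitePoly hb
  -- Any pointwise square root will do; no continuity is required.
  obtain ⟨r, hr⟩ : ∃ r : ℂ → ℂ, ∀ z, r z ^ 2 = (finitePoly b).eval z :=
    ⟨fun z => (finitePoly b).eval z ^ (1 / 2 : ℂ), fun z => by
      rw [← Complex.cpow_nat_mul]; norm_num⟩
  obtain ⟨K, hK⟩ := ω.exists_norm_coeff_le hn
  have hmem : ∀ z, (z, r z) ∈ planeCurve (finitePoly b) := hr
  have hmem' : ∀ z, (z, -r z) ∈ planeCurve (finitePoly b) := fun z => by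
    change (-r z) ^ 2 = _
    rw [neg_sq, hr z]
  obtain ⟨P, hP, hPE⟩ := exists_polynomial_of_growth (n - 1) _
    (differentiable_symmetric_coeff hf ω.finite hr (S := fun x => (x.1 + x.2) * 2⁻¹)
      (by fun_prop) (fun x y => by ring)) K <| by
    filter_upwards [hK] with z hz
    have h1 := hz _ (hmem z)
    have h2 := hz _ (hmem' z)
    have h3 := norm_add_le (ω.finite.coeff (z, r z)) (ω.finite.coeff (z, -r z))
    simp only [norm_mul, norm_inv, Complex.norm_two]
    linarith
  obtain ⟨Q, hQ, hQE⟩ := exists_polynomial_of_growth (2 * (n - 1)) _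
    (differentiable_symmetric_coeff hf ω.finite hr (S := fun x => (x.1 - x.2) ^ 2)
      (by fun_prop) (fun x y => by ring)) (4 * K ^ 2) <| by
    filter_upwards [hK] with z hz
    have h1 := hz _ (hmem z)
    have h2 := hz _ (hmem' z)
    have h3 := norm_sub_le (ω.finite.coeff (z, r z)) (ω.finite.coeff (z, -r z))
    rw [norm_pow]
    calc _ ≤ (2 * (K * ‖z‖ ^ (n - 1))) ^ 2 := by
          gcongr
          linarith
      _ = _ := by ring
  -- The sheets coincide at the `2 * n + 1` branch points, more zeros than the degree bound `2 * (n
  -- - 1)` allows.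
  have hQ0 : Q = 0 := by
    refine Q.eq_zero_of_natDegree_lt_card_of_eval_eq_zero (f := fun i => (b i : ℂ))
      (Complex.ofReal_injective.comp hb.injective) (fun i => ?_) ?_
    · have h1 : (finitePoly b).eval (b i : ℂ) = 0 := by
        rw [eval_finitePoly, Finset.prod_eq_zero (Finset.mem_univ i) (sub_self _), neg_zero]
      have h2 : r (b i) = 0 := by simpa [h1] using hr (b i)
      rw [← hQE]
      simp [h2]
    · rw [Fintype.card_fin]
      omega
  refine ⟨fun j => P.coeff j, fun p hp => ?_⟩
  have h1 : ω.finite.coeff (p.1, r p.1) = ω.finite.coeff (p.1, -r p.1) := by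
    have := hQE p.1
    simpa [hQ0, sub_eq_zero] using this
  have h2 : ω.finite.coeff (p.1, r p.1) = P.eval p.1 := by
    rw [← hPE, ← h1]
    ring
  have h3 : ω.finite.coeff p = P.eval p.1 := by
    have hp' : p.2 ^ 2 = r p.1 ^ 2 := by rw [hr]; exact hp
    rcases sq_eq_sq_iff_eq_or_eq_neg.1 hp' with h | h
    · rw [← h2, ← h]
    · rw [← h2, h1, ← h]
  rw [h3, eval_eq_sum_range' (n := n) (by omega), Finset.sum_range]

/-! ### Reality of the ovals -/

/-- The polynomial `-∏ (x - b i)` with real coefficients. -/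
def realPoly (b : Fin (2 * n + 1) → ℝ) : ℝ[X] := -∏ i, (X - C (b i))

theorem finitePoly_eq_map (b : Fin (2 * n + 1) → ℝ) :
    finitePoly b = (realPoly b).map Complex.ofRealHom := by
  simp [finitePoly, realPoly, Polynomial.map_prod]

theorem eval_finitePoly_ofReal (b : Fin (2 * n + 1) → ℝ) (x : ℝ) :
    (finitePoly b).eval (x : ℂ) = (((realPoly b).eval x : ℝ) : ℂ) := by
  rw [finitePoly_eq_map, eval_map]
  exact eval₂_hom Complex.ofRealHom x

theorem eval_derivative_finitePoly_ofReal (b : Fin (2 * n + 1) → ℝ) (x : ℝ) :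
    (finitePoly b).derivative.eval (x : ℂ) = (((realPoly b).derivative.eval x : ℝ) : ℂ) := by
  rw [finitePoly_eq_map, derivative_map, eval_map]
  exact eval₂_hom Complex.ofRealHom x

theorem prod_range_two_mul_add_one (u : ℕ → ℝ) (n : ℕ) :
    ∏ i ∈ Finset.range (2 * n + 1), u i =
      u 0 * ∏ j ∈ Finset.range n, (u (2 * j + 1) * u (2 * j + 2)) := by
  induction n with
  | zero => simp
  | succ n ih =>
    rw [show 2 * (n + 1) + 1 = 2 * n + 1 + 1 + 1 by ring, Finset.prod_range_succ,
      Finset.prod_range_succ, ih, Finset.prod_range_succ]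
    ring

/-- The left end of the `k`-th gap. -/
abbrev gapLeft (b : Fin (2 * n + 1) → ℝ) (k : Fin n) : ℝ := b ⟨2 * k + 1, by omega⟩

/-- The right end of the `k`-th gap. -/
abbrev gapRight (b : Fin (2 * n + 1) → ℝ) (k : Fin n) : ℝ := b ⟨2 * k + 2, by omega⟩

/-- Pair the factors at the two ends of each gap: a pair has nonpositive product for the `k`-th gap
and nonnegative product for the others. The factor of `b 0` is nonnegative, and the leading minus
sign does the rest. -/
theorem realPoly_nonneg (hb : StrictMono b) (k : Fin n) {x : ℝ}
    (hx : x ∈ Icc (gapLeft b k) (gapRight b k)) : 0 ≤ (realPoly b).eval x := by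
  set u : ℕ → ℝ := fun i => if h : i < 2 * n + 1 then x - b ⟨i, h⟩ else 1 with hu
  have hu' : ∀ i (h : i < 2 * n + 1), u i = x - b ⟨i, h⟩ := fun i h => dif_pos h
  have h1 : (realPoly b).eval x = -∏ i ∈ Finset.range (2 * n + 1), u i := by
    rw [Finset.prod_range]
    simp only [realPoly, eval_neg, eval_prod, eval_sub, eval_X, eval_C]
    congr 1
    exact Finset.prod_congr rfl fun i _ => (hu' i i.2).symm
  have hk := k.2
  have hlow : ∀ i (h : i < 2 * n + 1), i ≤ 2 * k + 1 → 0 ≤ u i := fun i h hi => by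
    rw [hu' i h, sub_nonneg]
    exact (hb.monotone (show (⟨i, h⟩ : Fin (2 * n + 1)) ≤ ⟨2 * k + 1, by omega⟩ from hi)).trans hx.1
  have hhigh : ∀ i (h : i < 2 * n + 1), 2 * k + 2 ≤ i → u i ≤ 0 := fun i h hi => by
    rw [hu' i h, sub_nonpos]
    exact hx.2.trans
      (hb.monotone (show (⟨2 * k + 2, by omega⟩ : Fin (2 * n + 1)) ≤ ⟨i, h⟩ from hi))
  rw [h1, prod_range_two_mul_add_one, neg_nonneg,
    ← Finset.mul_prod_erase _ _ (Finset.mem_range.2 hk)]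
  refine mul_nonpos_of_nonneg_of_nonpos (hlow 0 (by omega) (by omega)) ?_
  refine mul_nonpos_of_nonpos_of_nonneg (mul_nonpos_of_nonneg_of_nonpos
    (hlow _ (by omega) le_rfl) (hhigh _ (by omega) le_rfl)) (Finset.prod_nonneg fun j hj => ?_)
  obtain ⟨hjk, hjn⟩ := Finset.mem_erase.1 hj
  have hjn := Finset.mem_range.1 hjn
  rcases lt_or_gt_of_ne hjk with h | h
  · exact mul_nonneg (hlow _ (by omega) (by omega)) (hlow _ (by omega) (by omega))
  · exact mul_nonneg_of_nonpos_of_nonpos (hhigh _ (by omega) (by omega))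
      (hhigh _ (by omega) (by omega))

/-- The points of the ovals are real. -/
theorem exists_real_of_mem_oval (hb : StrictMono b) {k : Fin n} {p : ℂ × ℂ} (hp : p ∈ oval b k) :
    p.1.re ∈ Icc (gapLeft b k) (gapRight b k) ∧ p = ((p.1.re : ℂ), (p.2.re : ℂ)) := by
  obtain ⟨hp, x, h1, h2, h3⟩ := hp
  have hp' : p.2 ^ 2 = (finitePoly b).eval p.1 := hp
  have h0 := realPoly_nonneg hb k (x := x) ⟨h1, h2⟩
  rw [h3, eval_finitePoly_ofReal, ← Real.sq_sqrt h0, Complex.ofReal_pow] at hp'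
  refine ⟨by rw [h3]; exact ⟨h1, h2⟩, ?_⟩
  ext
  · simp [h3]
  · rcases sq_eq_sq_iff_eq_or_eq_neg.1 hp' with h | h <;> simp [h]

/-! ### The density of `dλ / w` along a regular path -/

/-- The coordinate `λ` of a path with real values. -/
def pathCoord (γ : ℝ → ℂ × ℂ) (t : ℝ) : ℝ := (γ t).1.re

/-- The density of `dλ / w` along a path with real values. -/
def pathWeight (b : Fin (2 * n + 1) → ℝ) (γ : ℝ → ℂ × ℂ) (t : ℝ) : ℝ :=
  (tangentCoord (finitePoly b) (γ t) (velocity γ t)).re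

namespace IsRegularPathIn

variable {k : Fin n} {γ : ℝ → ℂ × ℂ}

theorem hasDerivWithinAt {S : Set (ℂ × ℂ)} (h : IsRegularPathIn γ S) {t : ℝ}
    (ht : t ∈ Icc (0 : ℝ) 1) : HasDerivWithinAt γ (velocity γ t) (Icc 0 1) t :=
  ((h.contDiffOn.differentiableOn one_ne_zero) t ht).hasDerivWithinAt

/-- A real linear function that vanishes along the path vanishes on the velocity. -/
theorem apply_velocity_eq_zero {S : Set (ℂ × ℂ)} (h : IsRegularPathIn γ S)
    (L : ℂ × ℂ →L[ℝ] ℝ) (hL : ∀ t ∈ Icc (0 : ℝ) 1, L (γ t) = 0) {t : ℝ}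
    (ht : t ∈ Icc (0 : ℝ) 1) : L (velocity γ t) = 0 := by
  have h1 := L.hasFDerivAt.comp_hasDerivWithinAt t (h.hasDerivWithinAt ht)
  have h2 := (hasDerivWithinAt_const t (Icc (0 : ℝ) 1) (0 : ℝ)).congr (f₁ := L ∘ γ) hL (hL t ht)
  exact (uniqueDiffOn_Icc zero_lt_one t ht).eq_deriv _ h1 h2

theorem velocity_mem_tangentLine (h : IsRegularPathIn γ (oval b k)) {t : ℝ}
    (ht : t ∈ Icc (0 : ℝ) 1) : velocity γ t ∈ tangentLine (finitePoly b) (γ t) := by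
  have h1 : HasDerivWithinAt (fun s => (γ s).1) (velocity γ t).1 (Icc 0 1) t :=
    (ContinuousLinearMap.fst ℝ ℂ ℂ).hasFDerivAt.comp_hasDerivWithinAt t (h.hasDerivWithinAt ht)
  have h2 : HasDerivWithinAt (fun s => (γ s).2) (velocity γ t).2 (Icc 0 1) t :=
    (ContinuousLinearMap.snd ℝ ℂ ℂ).hasFDerivAt.comp_hasDerivWithinAt t (h.hasDerivWithinAt ht)
  have h3 := ((finitePoly b).hasDerivAt (γ t).1).comp_hasDerivWithinAt t h1
  have h4 := (h2.pow 2).congr (f₁ := fun s => (finitePoly b).eval (γ s).1)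
    (fun s hs => (h.mem s hs).1.symm) (h.mem t ht).1.symm
  have h5 := (uniqueDiffOn_Icc zero_lt_one t ht).eq_deriv _ h4 h3
  change 2 * (γ t).2 * (velocity γ t).2 = _
  rw [← h5]
  norm_num

theorem velocity_real (hb : StrictMono b) (h : IsRegularPathIn γ (oval b k)) {t : ℝ}
    (ht : t ∈ Icc (0 : ℝ) 1) :
    velocity γ t = (((velocity γ t).1.re : ℂ), ((velocity γ t).2.re : ℂ)) := by
  have h1 := h.apply_velocity_eq_zero (Complex.imCLM.comp (ContinuousLinearMap.fst ℝ ℂ ℂ))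
    (fun s hs => by
      have := (exists_real_of_mem_oval hb (h.mem s hs)).2
      rw [this]
      simp) ht
  have h2 := h.apply_velocity_eq_zero (Complex.imCLM.comp (ContinuousLinearMap.snd ℝ ℂ ℂ))
    (fun s hs => by
      have := (exists_real_of_mem_oval hb (h.mem s hs)).2
      rw [this]
      simp) ht
  ext1
  · exact Complex.ext (by simp) (by simpa using h1)
  · exact Complex.ext (by simp) (by simpa using h2)

theorem tangentVector_real (hb : StrictMono b) (h : IsRegularPathIn γ (oval b k)) {t : ℝ}
    (ht : t ∈ Icc (0 : ℝ) 1) : tangentVector (finitePoly b) (γ t) =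
      (((γ t).2.re : ℂ), (((realPoly b).derivative.eval (pathCoord γ t) / 2 : ℝ) : ℂ)) := by
  have h1 := (exists_real_of_mem_oval hb (h.mem t ht)).2
  have h2 : (γ t).1 = ((γ t).1.re : ℂ) := congrArg Prod.fst h1
  have h3 : (γ t).2 = ((γ t).2.re : ℂ) := congrArg Prod.snd h1
  ext1
  · exact h3
  · simp only [tangentVector, pathCoord]
    conv_lhs => rw [h2]
    rw [eval_derivative_finitePoly_ofReal]
    push_cast
    rfl

theorem denom_pos (hb : StrictMono b) (h : IsRegularPathIn γ (oval b k)) {t : ℝ}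
    (ht : t ∈ Icc (0 : ℝ) 1) :
    0 < (γ t).2.re ^ 2 + ((realPoly b).derivative.eval (pathCoord γ t) / 2) ^ 2 := by
  refine lt_of_le_of_ne (by positivity) fun h0 => ?_
  have h1 : (γ t).2.re = 0 :=
    pow_eq_zero_iff two_ne_zero |>.1
      ((add_eq_zero_iff_of_nonneg (sq_nonneg _) (sq_nonneg _)).1 h0.symm).1
  have h2 : (realPoly b).derivative.eval (pathCoord γ t) / 2 = 0 := by
    rw [h1] at h0
    simpa using h0.symm
  have h3 := tangentCoord_tangentVector (hasSimpleRoots_finitePoly hb) (h.mem t ht).1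
  rw [h.tangentVector_real hb ht, h1, h2] at h3
  have h4 : (((0 : ℝ) : ℂ), ((0 : ℝ) : ℂ)) = 0 := by simp
  rw [h4, map_zero] at h3
  exact zero_ne_one h3

/-- Since `velocity = c • T` with both vectors real, `c = ⟨T, velocity⟩ / ⟨T, T⟩`. Unlike the
definition by cases of `tangentCoord`, this formula is visibly real and continuous through branch
points. -/
theorem tangentCoord_velocity (hb : StrictMono b) (h : IsRegularPathIn γ (oval b k)) {t : ℝ}
    (ht : t ∈ Icc (0 : ℝ) 1) : tangentCoord (finitePoly b) (γ t) (velocity γ t) =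
      (((((γ t).2.re * (velocity γ t).1.re +
        (realPoly b).derivative.eval (pathCoord γ t) / 2 * (velocity γ t).2.re) /
        ((γ t).2.re ^ 2 + ((realPoly b).derivative.eval (pathCoord γ t) / 2) ^ 2) : ℝ)) : ℂ) := by
  have h1 := tangentCoord_smul (hasSimpleRoots_finitePoly hb) (h.mem t ht).1
    (h.velocity_mem_tangentLine ht)
  have h2 := h.denom_pos hb ht
  set c := tangentCoord (finitePoly b) (γ t) (velocity γ t)
  rw [h.tangentVector_real hb ht, h.velocity_real hb ht] at h1
  have h3 := congrArg Prod.fst h1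
  have h4 := congrArg Prod.snd h1
  simp only [Prod.smul_mk, smul_eq_mul] at h3 h4
  rw [Complex.ofReal_div, eq_div_iff (by exact_mod_cast h2.ne')]
  rw [Complex.ofReal_add, Complex.ofReal_add, Complex.ofReal_mul, Complex.ofReal_mul, ← h3, ← h4]
  push_cast
  ring

theorem tangentCoord_velocity_eq_pathWeight (hb : StrictMono b)
    (h : IsRegularPathIn γ (oval b k)) {t : ℝ} (ht : t ∈ Icc (0 : ℝ) 1) :
    tangentCoord (finitePoly b) (γ t) (velocity γ t) = (pathWeight b γ t : ℂ) := by
  rw [pathWeight, h.tangentCoord_velocity hb ht, Complex.ofReal_re]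

theorem pathWeight_smul_tangentVector (hb : StrictMono b) (h : IsRegularPathIn γ (oval b k))
    {t : ℝ} (ht : t ∈ Icc (0 : ℝ) 1) :
    (pathWeight b γ t : ℂ) • tangentVector (finitePoly b) (γ t) = velocity γ t := by
  rw [← h.tangentCoord_velocity_eq_pathWeight hb ht]
  exact tangentCoord_smul (hasSimpleRoots_finitePoly hb) (h.mem t ht).1
    (h.velocity_mem_tangentLine ht)

theorem pathWeight_ne_zero (hb : StrictMono b) (h : IsRegularPathIn γ (oval b k))
    {t : ℝ} (ht : t ∈ Icc (0 : ℝ) 1) : pathWeight b γ t ≠ 0 := by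
  intro h0
  have := h.pathWeight_smul_tangentVector hb ht
  rw [h0, Complex.ofReal_zero, zero_smul] at this
  exact h.velocity_ne_zero t ht this.symm

theorem continuousOn_pathCoord {S : Set (ℂ × ℂ)} (h : IsRegularPathIn γ S) :
    ContinuousOn (pathCoord γ) (Icc 0 1) :=
  (Complex.continuous_re.comp continuous_fst).comp_continuousOn h.contDiffOn.continuousOn

theorem continuousOn_pathWeight (hb : StrictMono b) (h : IsRegularPathIn γ (oval b k)) :
    ContinuousOn (pathWeight b γ) (Icc 0 1) := by
  have hv : ContinuousOn (velocity γ) (Icc 0 1) :=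
    h.contDiffOn.continuousOn_derivWithin (uniqueDiffOn_Icc zero_lt_one) le_rfl
  have hv1 := (Complex.continuous_re.comp continuous_fst).comp_continuousOn hv
  have hv2 := (Complex.continuous_re.comp continuous_snd).comp_continuousOn hv
  have hy := (Complex.continuous_re.comp continuous_snd).comp_continuousOn
    h.contDiffOn.continuousOn
  have hd := ((realPoly b).derivative.continuous.comp_continuousOn
    h.continuousOn_pathCoord).div_const 2
  refine (((hy.mul hv1).add (hd.mul hv2)).div ((hy.pow 2).add (hd.pow 2))
    fun t ht => (h.denom_pos hb ht).ne').congr fun t ht => ?_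
  rw [pathWeight, h.tangentCoord_velocity hb ht, Complex.ofReal_re]
  rfl

/-- A continuous nowhere zero function on an interval has constant sign. -/
theorem pathWeight_mul_pos (hb : StrictMono b) (h : IsRegularPathIn γ (oval b k))
    {s t : ℝ} (hs : s ∈ Icc (0 : ℝ) 1) (ht : t ∈ Icc (0 : ℝ) 1) :
    0 < pathWeight b γ s * pathWeight b γ t := by
  have hc := h.continuousOn_pathWeight hb
  by_contra hneg
  have h0 : (0 : ℝ) ∈ pathWeight b γ '' Icc 0 1 := by
    rcases mul_nonpos_iff.1 (not_lt.1 hneg) with h1 | h1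
    · exact isPreconnected_Icc.intermediate_value ht hs hc ⟨h1.2, h1.1⟩
    · exact isPreconnected_Icc.intermediate_value hs ht hc ⟨h1.1, h1.2⟩
  obtain ⟨u, hu, hu0⟩ := h0
  exact h.pathWeight_ne_zero hb hu hu0

/-- The path does not stay over the ends of the gap. -/
theorem exists_pathCoord_mem_Ioo (hb : StrictMono b) (h : IsRegularPathIn γ (oval b k)) :
    ∃ t ∈ Icc (0 : ℝ) 1, pathCoord γ t ∈ Ioo (gapLeft b k) (gapRight b k) := by
  by_contra! hno
  have hy : ∀ t ∈ Icc (0 : ℝ) 1, (γ t).2 = 0 := by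
    intro t ht
    obtain ⟨⟨h1, h2⟩, h3⟩ := exists_real_of_mem_oval hb (h.mem t ht)
    have h4 : (γ t).1 = ((γ t).1.re : ℂ) := congrArg Prod.fst h3
    have h5 : (γ t).2 ^ 2 = (finitePoly b).eval (γ t).1 := (h.mem t ht).1
    have h6 : ∃ i, b i = (γ t).1.re := by
      rcases h1.eq_or_lt with h1 | h1
      · exact ⟨_, h1⟩
      · rcases h2.eq_or_lt with h2 | h2
        · exact ⟨_, h2.symm⟩
        · exact absurd ⟨h1, h2⟩ (hno t ht)
    obtain ⟨i, hi⟩ := h6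
    have h7 : (finitePoly b).eval (γ t).1 = 0 := by
      rw [eval_finitePoly, h4, ← hi, Finset.prod_eq_zero (Finset.mem_univ i) (sub_self _), neg_zero]
    simpa [h7] using h5
  have h0 : (0 : ℝ) ∈ Icc (0 : ℝ) 1 := by simp
  -- With `w = 0` throughout, the velocity has no `w`-component; but at a branch point the tangent
  -- line is the `w`-direction, so the velocity would vanish.
  have h1 := h.apply_velocity_eq_zero (Complex.reCLM.comp (ContinuousLinearMap.snd ℝ ℂ ℂ))
    (fun t ht => by simp [hy t ht]) h0
  have h2 := derivative_ne_zero_of_mem (hasSimpleRoots_finitePoly hb) (h.mem 0 h0).1 (hy 0 h0)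
  have h3 := congrArg Prod.snd (h.pathWeight_smul_tangentVector hb h0)
  have h4 := congrArg Prod.snd (h.velocity_real hb h0)
  have h5 : (velocity γ 0).2 = 0 := by
    rw [h4]
    simpa using h1
  rw [h5] at h3
  simp [tangentVector, h2, h.pathWeight_ne_zero hb h0] at h3

end IsRegularPathIn

/-! ### Moments and positivity of integrals -/

/-- The integral of `λ ^ j dλ / w` along a path with real values. -/
def moment (b : Fin (2 * n + 1) → ℝ) (γ : ℝ → ℂ × ℂ) (j : ℕ) : ℝ :=
  ∫ t in (0 : ℝ)..1, pathCoord γ t ^ j * pathWeight b γ t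

namespace IsRegularPathIn

variable {k : Fin n} {γ : ℝ → ℂ × ℂ}

theorem sum_moment_mul (hb : StrictMono b) (h : IsRegularPathIn γ (oval b k)) (a : Fin n → ℝ) :
    ∑ j : Fin n, moment b γ j * a j =
      ∫ t in (0 : ℝ)..1, (∑ j : Fin n, a j * pathCoord γ t ^ (j : ℕ)) * pathWeight b γ t := by
  simp_rw [Finset.sum_mul]
  rw [intervalIntegral.integral_finsetSum]
  · refine Finset.sum_congr rfl fun j _ => ?_
    simp_rw [mul_assoc]
    rw [intervalIntegral.integral_const_mul, mul_comm, moment]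
  · intro j _
    refine ContinuousOn.intervalIntegrable_of_Icc zero_le_one ?_
    exact (continuousOn_const.mul (h.continuousOn_pathCoord.pow _)).mul
      (h.continuousOn_pathWeight hb)

/-- A real form that is positive over the open gap has a non-zero integral along the path. -/
theorem mul_sum_moment_pos (hb : StrictMono b) (h : IsRegularPathIn γ (oval b k)) {s : ℝ}
    (hs : ∀ t ∈ Icc (0 : ℝ) 1, 0 < pathWeight b γ t * s) {a : Fin n → ℝ}
    (ha : ∀ x ∈ Ioo (gapLeft b k) (gapRight b k), 0 < ∑ j : Fin n, a j * x ^ (j : ℕ)) :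
    0 < s * ∑ j : Fin n, moment b γ j * a j := by
  have hlt : gapLeft b k < gapRight b k :=
    hb (show (⟨2 * k + 1, _⟩ : Fin (2 * n + 1)) < ⟨2 * k + 2, _⟩ from Nat.lt_succ_self _)
  -- The path may touch the ends of the gap, where continuity still gives nonnegativity.
  have ha' : ∀ x ∈ Icc (gapLeft b k) (gapRight b k), 0 ≤ ∑ j : Fin n, a j * x ^ (j : ℕ) := by
    rw [← closure_Ioo hlt.ne]
    exact closure_minimal (fun x hx => (ha x hx).le)
      (isClosed_le continuous_const (by fun_prop) :
        IsClosed {x : ℝ | 0 ≤ ∑ j : Fin n, a j * x ^ (j : ℕ)})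
  rw [h.sum_moment_mul hb, ← intervalIntegral.integral_const_mul]
  refine intervalIntegral.integral_pos zero_lt_one ?_ ?_ ?_
  · refine continuousOn_const.mul (ContinuousOn.mul ?_ (h.continuousOn_pathWeight hb))
    exact continuousOn_finsetSum _ fun j _ =>
      continuousOn_const.mul (h.continuousOn_pathCoord.pow _)
  · intro t ht
    have ht' := Ioc_subset_Icc_self ht
    have h1 := ha' _ (exists_real_of_mem_oval hb (h.mem t ht')).1
    have h2 := mul_nonneg h1 (hs t ht').le
    unfold pathCoord
    linarith
  · obtain ⟨t, ht, hx⟩ := h.exists_pathCoord_mem_Ioo hb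
    have h2 := mul_pos (ha _ hx) (hs t ht)
    exact ⟨t, ht, by linarith⟩

theorem pathIntegral_eq (hb : StrictMono b) (h : IsRegularPathIn γ (oval b k))
    (ω : HolomorphicDifferential b) {a : Fin n → ℂ}
    (ha : ∀ p ∈ planeCurve (finitePoly b), ω.finite.coeff p = ∑ j, a j * p.1 ^ (j : ℕ)) :
    pathIntegral ω γ = ∑ j : Fin n, (moment b γ j : ℂ) * a j := by
  have h1 : pathIntegral ω γ = ∫ t in (0 : ℝ)..1, ∑ j : Fin n,
      a j * ((pathCoord γ t ^ (j : ℕ) * pathWeight b γ t : ℝ) : ℂ) := by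
    refine intervalIntegral.integral_congr fun t ht => ?_
    rw [uIcc_of_le zero_le_one] at ht
    have h2 := congrArg Prod.fst (exists_real_of_mem_oval hb (h.mem t ht)).2
    rw [← h.pathWeight_smul_tangentVector hb ht,
      HolomorphicForm.eval_smul_tangentVector _ (h.mem t ht).1, ha _ (h.mem t ht).1,
      Finset.mul_sum]
    refine Finset.sum_congr rfl fun j _ => ?_
    rw [h2]
    push_cast
    simp only [pathCoord]
    ring
  rw [h1, intervalIntegral.integral_finsetSum]
  · refine Finset.sum_congr rfl fun j _ => ?_
    rw [intervalIntegral.integral_const_mul, intervalIntegral.integral_ofReal, mul_comm, moment]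
  · intro j _
    refine ContinuousOn.intervalIntegrable_of_Icc zero_le_one ?_
    exact continuousOn_const.mul (Complex.continuous_ofReal.comp_continuousOn
      ((h.continuousOn_pathCoord.pow _).mul (h.continuousOn_pathWeight hb)))

/-- Velocities that are proportional have proportional weights. -/
theorem pathWeight_eq_mul (hb : StrictMono b) {a : ℝ → ℂ × ℂ}
    (h : IsRegularPathIn γ (oval b k)) (ha : IsRegularPathIn a (oval b k)) {s t c : ℝ}
    (ht : t ∈ Icc (0 : ℝ) 1) (hs : s ∈ Icc (0 : ℝ) 1) (he : γ t = a s)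
    (hv : velocity γ t = c • velocity a s) : pathWeight b γ t = c * pathWeight b a s := by
  have h1 := h.tangentCoord_velocity_eq_pathWeight hb ht
  have h2 := ha.tangentCoord_velocity_eq_pathWeight hb hs
  rw [hv, he, ← Complex.coe_smul, map_smul, h2, smul_eq_mul] at h1
  exact_mod_cast h1.symm

end IsRegularPathIn

/-! ### Non-degeneracy by counting zeros in the gaps -/

/-- If the rows of `M` are functionals on real polynomials of degree `< n`, the `k`-th of which does
not vanish on polynomials without zeros in the `k`-th gap, then `M` is non-degenerate. -/
theorem det_ne_zero_of_gap_pos (hb : StrictMono b) (M : Matrix (Fin n) (Fin n) ℝ)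
    (H : ∀ k, ∃ s : ℝ, ∀ a : Fin n → ℝ,
      (∀ x ∈ Ioo (gapLeft b k) (gapRight b k), 0 < ∑ j : Fin n, a j * x ^ (j : ℕ)) →
        0 < s * ∑ j, M k j * a j) : M.det ≠ 0 := by
  intro hdet
  obtain ⟨a, ha0, ha⟩ := Matrix.exists_mulVec_eq_zero_iff.2 hdet
  have hrow : ∀ k, ∑ j, M k j * a j = 0 := fun k => congrFun ha k
  have hroot : ∀ k, ∃ x ∈ Ioo (gapLeft b k) (gapRight b k),
      ∑ j : Fin n, a j * x ^ (j : ℕ) = 0 := by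
    intro k
    by_contra! hno
    obtain ⟨s, hs⟩ := H k
    have hc : ContinuousOn (fun x : ℝ => ∑ j : Fin n, a j * x ^ (j : ℕ))
        (Ioo (gapLeft b k) (gapRight b k)) := by fun_prop
    by_cases hpos : ∀ x ∈ Ioo (gapLeft b k) (gapRight b k), 0 < ∑ j : Fin n, a j * x ^ (j : ℕ)
    · simpa [hrow k] using hs a hpos
    · push Not at hpos
      obtain ⟨x, hx, hx0⟩ := hpos
      -- A polynomial without zeros in the gap that is nonpositive at one point is negative on all
      -- of it, so `H` applies to `-a`.
      have hneg : ∀ y ∈ Ioo (gapLeft b k) (gapRight b k),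
          0 < ∑ j : Fin n, (-a) j * y ^ (j : ℕ) := by
        intro y hy
        by_contra hy0
        simp only [Pi.neg_apply, neg_mul, Finset.sum_neg_distrib, Left.neg_pos_iff, not_lt] at hy0
        obtain ⟨z, hz, hz0⟩ := isPreconnected_Ioo.intermediate_value hx hy hc ⟨hx0, hy0⟩
        exact hno z hz hz0
      simpa [hrow k] using hs (-a) hneg
  choose x hx hx0 using hroot
  -- Distinct gaps are disjoint, so the `n` zeros are distinct and a Vandermonde argument kills `a`.
  have hmono : StrictMono x := fun k l hkl => by
    have h1 : gapRight b k ≤ gapLeft b l := hb.monotone <| by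
      change 2 * (k : ℕ) + 2 ≤ 2 * l + 1
      have : (k : ℕ) < l := hkl
      omega
    exact (hx k).2.trans_le (h1.trans (hx l).1.le)
  exact ha0 (Matrix.eq_zero_of_forall_index_sum_mul_pow_eq_zero hmono.injective hx0)

variable {N : ℕ} {γ : Fin N → ℝ → ℂ × ℂ} {κ : Fin N → Fin n}

theorem groupIntegral_eq (hb : StrictMono b)
    (hγ : ∀ i, IsRegularPathIn (γ i) (oval b (κ i))) (ω : HolomorphicDifferential b)
    {a : Fin n → ℂ}
    (ha : ∀ p ∈ planeCurve (finitePoly b), ω.finite.coeff p = ∑ j, a j * p.1 ^ (j : ℕ))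
    (k : Fin n) : groupIntegral ω γ κ k =
      ∑ j : Fin n, ((∑ i with κ i = k, moment b (γ i) j : ℝ) : ℂ) * a j := by
  simp only [groupIntegral, (hγ _).pathIntegral_eq hb ω ha, Complex.ofReal_sum, Finset.sum_mul]
  exact Finset.sum_comm

/-- All paths that run in the same direction of an oval have weights of the same sign. -/
theorem exists_sign {a : ℝ → ℂ × ℂ} {k : Fin n} (hb : StrictMono b)
    (ha : IsCycle a (oval b k)) (hγ : ∀ i, IsRegularPathIn (γ i) (oval b (κ i)))
    (horient : (∀ i, κ i = k → PositivelyOriented (γ i) a) ∨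
      (∀ i, κ i = k → NegativelyOriented (γ i) a)) :
    ∃ s : ℝ, ∀ i, κ i = k → ∀ t ∈ Icc (0 : ℝ) 1, 0 < pathWeight b (γ i) t * s := by
  have ha' := ha.toIsRegularPathIn
  have h0 : (0 : ℝ) ∈ Icc (0 : ℝ) 1 := by simp
  rcases horient with h | h
  · refine ⟨pathWeight b a 0, fun i hi t ht => ?_⟩
    have hr := hi ▸ hγ i
    obtain ⟨u, hu, he⟩ := ha.surjOn (hr.mem t ht)
    obtain ⟨c, hc, hv⟩ := h i hi t ht u hu he.symm
    rw [hr.pathWeight_eq_mul hb ha' ht hu he.symm hv, mul_assoc]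
    exact mul_pos hc (ha'.pathWeight_mul_pos hb hu h0)
  · refine ⟨-pathWeight b a 0, fun i hi t ht => ?_⟩
    have hr := hi ▸ hγ i
    obtain ⟨u, hu, he⟩ := ha.surjOn (hr.mem t ht)
    obtain ⟨c, hc, hv⟩ := h i hi t ht u hu he.symm
    rw [hr.pathWeight_eq_mul hb ha' ht hu he.symm hv, mul_neg, mul_assoc, ← neg_mul]
    exact mul_pos (neg_pos.2 hc) (ha'.pathWeight_mul_pos hb hu h0)

/-- The moments of the groups of paths with index in `J` and of the remaining cycles. -/
def momentMatrix (b : Fin (2 * n + 1) → ℝ) (α : Fin n → ℝ → ℂ × ℂ) (γ : Fin N → ℝ → ℂ × ℂ)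
    (κ : Fin N → Fin n) (J : Finset (Fin n)) : Matrix (Fin n) (Fin n) ℝ :=
  Matrix.of fun k j => if k ∈ J then ∑ i with κ i = k, moment b (γ i) j else moment b (α k) j

/-- Every row, whether from a group or from a cycle, integrates against a density of constant sign.
The determinant is real, so it stays nonzero over `ℂ`, where the coefficients of differentials live.
-/
theorem det_momentMatrix_ne_zero (hb : StrictMono b) {α : Fin n → ℝ → ℂ × ℂ}
    (hα : ∀ k, IsCycle (α k) (oval b k)) (hγ : ∀ i, IsRegularPathIn (γ i) (oval b (κ i)))
    (horient : ∀ k, (∀ i, κ i = k → PositivelyOriented (γ i) (α k)) ∨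
      (∀ i, κ i = k → NegativelyOriented (γ i) (α k)))
    {J : Finset (Fin n)} (hJ : ∀ k ∈ J, ∃ i, κ i = k) :
    ((momentMatrix b α γ κ J).map Complex.ofReal).det ≠ 0 := by
  have h1 : (momentMatrix b α γ κ J).det ≠ 0 := by
    refine det_ne_zero_of_gap_pos hb _ fun k => ?_
    by_cases hk : k ∈ J
    · obtain ⟨s, hs⟩ := exists_sign hb (hα k) hγ (horient k)
      refine ⟨s, fun a ha => ?_⟩
      simp only [momentMatrix, Matrix.of_apply, if_pos hk, Finset.sum_mul]
      rw [Finset.sum_comm, Finset.mul_sum]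
      refine Finset.sum_pos (fun i hi => ?_) ?_
      · have hi := (Finset.mem_filter.1 hi).2
        exact (hi ▸ hγ i : IsRegularPathIn (γ i) (oval b k)).mul_sum_moment_pos hb (hs i hi) ha
      · obtain ⟨i, hi⟩ := hJ k hk
        exact ⟨i, by simpa using hi⟩
    · have hr := (hα k).toIsRegularPathIn
      refine ⟨pathWeight b (α k) 0, fun a ha => ?_⟩
      simp only [momentMatrix, Matrix.of_apply, if_neg hk]
      exact hr.mul_sum_moment_pos hb
        (fun t ht => hr.pathWeight_mul_pos hb ht (by simp)) ha
  have h2 := RingHom.map_det Complex.ofRealHom (momentMatrix b α γ κ J)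
  rw [RingHom.mapMatrix_apply] at h2
  change (Matrix.map _ Complex.ofRealHom).det ≠ 0
  rw [← h2]
  exact Complex.ofReal_ne_zero.2 h1

end RealHyperelliptic

end

theorem mainTheorem8 (n : ℕ) (b : Fin (2 * n + 1) → ℝ) (hb : StrictMono b)
    (α : Fin n → ℝ → ℂ × ℂ)
    (hα : ∀ k, RealHyperelliptic.IsCycle (α k) (RealHyperelliptic.oval b k))
    (N : ℕ) (γ : Fin N → ℝ → ℂ × ℂ) (κ : Fin N → Fin n)
    (hγ : ∀ i, RealHyperelliptic.IsRegularPathIn (γ i) (RealHyperelliptic.oval b (κ i)))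
    (horient : ∀ k,
      (∀ i, κ i = k → RealHyperelliptic.PositivelyOriented (γ i) (α k)) ∨
      (∀ i, κ i = k → RealHyperelliptic.NegativelyOriented (γ i) (α k))) :
    (∀ k : Fin n, (∃ i, κ i = k) →
      ∃ ω : RealHyperelliptic.HolomorphicDifferential b, ∀ l : Fin n,
        RealHyperelliptic.groupIntegral ω γ κ l = if k = l then 1 else 0) ∧
    (∀ ωhat : Fin n → RealHyperelliptic.HolomorphicDifferential b,
      (∀ j k, RealHyperelliptic.pathIntegral (ωhat k) (α j) = if j = k then 1 else 0) →
      ∀ J : Finset (Fin n), (∀ k ∈ J, ∃ i, κ i = k) →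
        (Matrix.of fun k l : J =>
          RealHyperelliptic.groupIntegral (ωhat l) γ κ k).det ≠ 0) := by
  open RealHyperelliptic in
  constructor
  · intro k hk
    classical
    -- Rows of empty groups would be zero; cycle rows in their place keep the system square and
    -- invertible.
    set J : Finset (Fin n) := Finset.univ.filter fun l => ∃ i, κ i = l with hJdef
    have hJ : ∀ l, l ∈ J ↔ ∃ i, κ i = l := fun l => by simp [hJdef]
    have hdet := det_momentMatrix_ne_zero hb hα hγ horient fun l hl => (hJ l).1 hl
    set M := (momentMatrix b α γ κ J).map Complex.ofReal with hM
    set a : Fin n → ℂ := M⁻¹.mulVec (Pi.single k 1) with ha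
    have hMa : M.mulVec a = Pi.single k 1 := by
      rw [ha, Matrix.mulVec_mulVec, Matrix.mul_nonsing_inv _ (isUnit_iff_ne_zero.2 hdet),
        Matrix.one_mulVec]
    refine ⟨polyDifferential hb a, fun l => ?_⟩
    by_cases hl : l ∈ J
    · rw [groupIntegral_eq hb hγ _ (fun p hp => coeff_polyDifferential hb a hp) l]
      have h1 := congrFun hMa l
      simp only [hM, Matrix.mulVec, dotProduct, Matrix.map_apply, momentMatrix, Matrix.of_apply,
        if_pos hl] at h1
      rw [h1, Pi.single_apply]
      simp only [eq_comm]
    · have hkl : k ≠ l := fun h => hl ((hJ l).2 (h ▸ hk))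
      rw [if_neg hkl, groupIntegral, Finset.sum_eq_zero]
      intro i hi
      exact absurd ((hJ l).2 ⟨i, (Finset.mem_filter.1 hi).2⟩) hl
  · intro ωhat hω J hJ hdet
    obtain ⟨c, hc0, hc⟩ := Matrix.exists_mulVec_eq_zero_iff.2 hdet
    obtain ⟨k₀, hk₀⟩ := Function.ne_iff.1 hc0
    have hn : 0 < n := k₀.1.pos
    choose a ha using fun l => (ωhat l).exists_coeff_eq hb hn
    -- The coefficients of the polynomial of `∑ c l ω̂ l`.
    set v : Fin n → ℂ := fun j => ∑ l : J, a l j * c l with hv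
    have hswap : ∀ m : Fin n → ℂ, ∑ j, m j * v j = ∑ l : J, (∑ j, m j * a l j) * c l := by
      intro m
      simp only [hv, Finset.mul_sum, Finset.sum_mul, mul_assoc]
      exact Finset.sum_comm
    have hcycle : ∀ k, ∑ j : Fin n, (moment b (α k) j : ℂ) * v j =
        ∑ l : J, (if k = l then 1 else 0) * c l := by
      intro k
      rw [hswap]
      refine Finset.sum_congr rfl fun l _ => ?_
      rw [← (hα k).toIsRegularPathIn.pathIntegral_eq hb (ωhat l) (ha l), hω]
    have hv0 : v = 0 := by
      refine Matrix.eq_zero_of_mulVec_eq_zero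
        (det_momentMatrix_ne_zero hb hα hγ horient hJ) (funext fun k => ?_)
      by_cases hk : k ∈ J
      · simp only [Matrix.mulVec, dotProduct, Matrix.map_apply, momentMatrix, Matrix.of_apply,
          if_pos hk]
        rw [hswap]
        refine (Finset.sum_congr rfl fun l _ => ?_).trans (congrFun hc ⟨k, hk⟩)
        rw [← groupIntegral_eq hb hγ (ωhat l) (ha l) k]
        rfl
      · simp only [Matrix.mulVec, dotProduct, Matrix.map_apply, momentMatrix, Matrix.of_apply,
          if_neg hk]
        rw [hcycle]
        refine Finset.sum_eq_zero fun l _ => ?_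
        rw [if_neg (fun h : k = ↑l => hk (h ▸ l.2)), zero_mul]
    -- The integral of the zero differential over the `k₀`-th cycle is `c k₀`.
    have h1 := hcycle k₀
    rw [hv0, Finset.sum_eq_single k₀] at h1
    · simp at h1
      exact hk₀ h1.symm
    · intro l _ hl
      rw [if_neg (fun h : (k₀ : Fin n) = ↑l => hl (Subtype.ext h.symm)), zero_mul]
    · simp
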